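/- Let $P$ be a finite poset. For $i\ge 0$ let $N_i(P)$ be the set of chains $x_0\le x_1\le\dots\le x_i$ in $P$ and $\overline{N_i}(P)$ the set of chains $x_0<x_1<\dots<x_i$. The dimension of $P$ is the greatest $i$ with $\overline{N_i}(P)\neq\emptyset$, and $\chi(P)=\sum_{i=0}^{\dim P}(-1)^i\,\#\overline{N_i}(P)$. The zeta series $Z_P(s)=\sum_{i\ge 0}\#N_i(P)\,s^i$ is the expansion at $0$ of a rational function, again denoted $Z_P$. The barycentric subdivision $\mathrm{Sd}(P)$ is the set of nonempty totally ordered subsets of $P$, ordered by inclusion, and $\mathrm{Sd}^k$ is its $k$-fold iterate. For integers $i,d\ge 0$ let $f_{i,d}$ be the number of chains $A_0\subsetneq A_1\subsetneq\dots\subsetneq A_i=\{0,1,\dots,d\}$ of nonempty sets. Put $F_{d,d}=1$ and, for $0\le i<d$, $$F_{i,d}=\sum_{\ell\ge 0}\ \sum_{i=i_0<i_1<\dots<i_\ell<i_{\ell+1}=d}\ \prod_{m=0}^{\ell}\frac{f_{i_m,i_{m+1}}}{(d+1)!-(i_m+1)!}.$$ Let $F_d(s)=\sum_{i=0}^{d}F_{i,d}\,s^{d-i}$,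 and let $H_{i,d}$ be the coefficient of $(s+1)^i$ in the expansion of $F_d(s)$ in powers of $s+1$. **Proposition.** Suppose that $P$ is a finite poset of dimension $d\ge 1$ with $\chi(P)\ne 0$. For each $k\ge 0$ let $\beta_1^{(k)},\dots,\beta_d^{(k)}$ be the complex zeros, listed with multiplicity, of $Z_{\mathrm{Sd}^k(P)}$, numbered so that $|\beta_1^{(k)}|=\max_{1\le i\le d}|\beta_i^{(k)}|$. Then $$|\beta_1^{(k)}|\sim\frac{(d+1)!^{\,k}\,H_{1,d}\,\#\overline{N_d}(P)}{|\chi(P)|}\qquad(k\to\infty),$$ that is, the quotient of the two sides tends to $1$. -/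

import Mathlib

namespace PosetZeta

universe u

section Chains

variable (P : Type u) [PartialOrder P]

/-- `N_i(P)`: chains `x₀ ≤ x₁ ≤ ⋯ ≤ x_i` of `i` composable morphisms of `P`, identities allowed. -/
abbrev Chain (i : ℕ) : Type u := {c : Fin (i + 1) → P // Monotone c}

/-- The nondegenerate chains of length `i`: chains `x₀ < x₁ < ⋯ < x_i` of `i` composable
nonidentity morphisms of `P`. -/
abbrev NondegChain (i : ℕ) : Type u := {c : Fin (i + 1) → P // StrictMono c}

/-- The dimension of `P`: the greatest `i` such that `P` has a nondegenerate chain of length `i`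
(used for finite nonempty `P`, where the set below is nonempty and bounded). -/
noncomputable def dim : ℕ := sSup {i : ℕ | Nonempty (NondegChain P i)}

/-- The Euler characteristic of a finite poset. -/
noncomputable def eulerChar : ℤ :=
  ∑ i ∈ Finset.range (dim P + 1), (-1) ^ i * (Nat.card (NondegChain P i) : ℤ)

/-- The underlying set of the barycentric subdivision of `P`: the nonempty totally ordered finite
subsets of `P`. Its order, inherited from `Finset P`, is inclusion. -/
abbrev SdCarrier : Type u := {s : Finset P // s.Nonempty ∧ IsChain (· ≤ ·) (s : Set P)}

end Chains

/-- Barycentric subdivision of a finite poset. -/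
noncomputable def Sd (Q : FinPartOrd.{u}) : FinPartOrd.{u} :=
  letI : Fintype (SdCarrier Q) := Fintype.ofFinite _
  FinPartOrd.of (SdCarrier Q)

/-- The `k`-fold iterated barycentric subdivision of the finite poset `P`. -/
noncomputable def iterSd (P : Type u) [PartialOrder P] [Fintype P] (k : ℕ) : FinPartOrd.{u} :=
  Sd^[k] (FinPartOrd.of P)

section Zeta

open scoped RatFunc

variable (P : Type u) [PartialOrder P]

/-- The zeta series `∑ i, #N_i(P) s ^ i`, as a formal power series. -/
noncomputable def zetaSeries : PowerSeries ℂ :=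
  PowerSeries.mk fun i => (Nat.card (Chain P i) : ℂ)

open Classical in
/-- The adjacency matrix of a poset. -/
noncomputable def adjMat : Matrix P P ℂ := fun x y => if x ≤ y then 1 else 0

open Classical in
theorem card_chain_eq [Fintype P] (n : ℕ) :
    (Nat.card (Chain P n) : ℂ) = ∑ x, ∑ y, (adjMat P ^ n) x y := by
  have key : ∀ (n : ℕ) (w : P → ℂ),
      ∑ f : Fin (n + 1) → P, w (f 0) * ∏ i : Fin n, adjMat P (f i.castSucc) (f i.succ)
        = ∑ x, ∑ y, w x * (adjMat P ^ n) x y := by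
    intro n
    induction n with
    | zero =>
      intro w
      rw [← (Equiv.funUnique (Fin 1) P).symm.sum_comp]
      simp [Matrix.one_apply]
    | succ n ih =>
      intro w
      rw [← (Fin.consEquiv fun _ => P).sum_comp, Fintype.sum_prod_type, Finset.sum_comm]
      have h1 : ∀ g : Fin (n + 1) → P,
          (∑ x, w ((Fin.consEquiv fun _ => P) (x, g) 0) *
            ∏ i : Fin (n + 1), adjMat P ((Fin.consEquiv fun _ => P) (x, g) i.castSucc)
              ((Fin.consEquiv fun _ => P) (x, g) i.succ))
          = (∑ x, w x * adjMat P x (g 0)) *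
              ∏ i : Fin n, adjMat P (g i.castSucc) (g i.succ) := by
        intro g
        rw [Finset.sum_mul]
        refine Finset.sum_congr rfl fun x _ => ?_
        rw [Fin.prod_univ_succ]
        simp [Fin.consEquiv, mul_assoc]
      rw [Finset.sum_congr rfl fun g _ => h1 g, ih fun y => ∑ x, w x * adjMat P x y]
      simp only [pow_succ', Matrix.mul_apply, Finset.sum_mul, Finset.mul_sum, mul_assoc]
      rw [Finset.sum_comm]
      conv_lhs => enter [2, y]; rw [Finset.sum_comm]
      rw [Finset.sum_comm]
  have h := key n fun _ => 1
  simp only [one_mul] at h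
  rw [← h, Nat.card_eq_fintype_card, Fintype.card_subtype, Finset.card_filter, Nat.cast_sum]
  refine Finset.sum_congr rfl fun f _ => ?_
  by_cases hf : Monotone f
  · rw [if_pos hf, Finset.prod_eq_one, Nat.cast_one]
    intro i _
    simp [adjMat, hf (Fin.castSucc_le_succ i)]
  · rw [if_neg hf, Nat.cast_zero]
    rw [Fin.monotone_iff_le_succ] at hf
    push Not at hf
    obtain ⟨i, hi⟩ := hf
    exact (Finset.prod_eq_zero (Finset.mem_univ i) (by simp [adjMat, hi])).symm

variable [Finite P]

/-- The zeta series of a finite poset is the expansion at `0` of a unique rational function. -/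
theorem existsUnique_zeta :
    ∃! R : RatFunc ℂ,
      algebraMap (RatFunc ℂ) (LaurentSeries ℂ) R = (zetaSeries P : LaurentSeries ℂ) := by
  classical
  have : Fintype P := Fintype.ofFinite P
  obtain ⟨p, q, hq, hpq⟩ : ∃ p q : Polynomial ℂ, q ≠ 0 ∧
      (q : PowerSeries ℂ) * zetaSeries P = (p : PowerSeries ℂ) := by
    let M : Matrix P P (Polynomial ℂ) := 1 - (Polynomial.X : Polynomial ℂ) • (adjMat P).map Polynomial.C
    let φ : Polynomial ℂ →+* PowerSeries ℂ := Polynomial.coeToPowerSeries.ringHom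
    let G : Matrix P P (PowerSeries ℂ) := fun x y => PowerSeries.mk fun n => (adjMat P ^ n) x y
    have hMG : φ.mapMatrix M * G = 1 := by
      have hM : φ.mapMatrix M
          = 1 - (PowerSeries.X : PowerSeries ℂ) • (adjMat P).map (PowerSeries.C (R := ℂ)) := by
        ext1 x y
        simp only [M, φ, RingHom.mapMatrix_apply, Matrix.map_apply, Matrix.sub_apply,
          Matrix.smul_apply, smul_eq_mul, map_sub, map_mul, Matrix.one_apply]
        by_cases hxy : x = y <;> simp [hxy]
      rw [hM, sub_mul, one_mul]
      ext x y n
      rw [Matrix.sub_apply, Matrix.smul_mul, Matrix.smul_apply, smul_eq_mul, map_sub]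
      cases n with
      | zero =>
        by_cases hxy : x = y <;> simp [G, Matrix.one_apply, hxy]
      | succ n =>
        rw [PowerSeries.coeff_succ_X_mul]
        have h1 : PowerSeries.coeff (n + 1) ((1 : Matrix P P (PowerSeries ℂ)) x y) = 0 := by
          by_cases hxy : x = y <;> simp [Matrix.one_apply, hxy]
        rw [h1, sub_eq_zero, Matrix.mul_apply, map_sum]
        simp only [G, PowerSeries.coeff_mk, pow_succ']
        rw [Matrix.mul_apply]
        refine Finset.sum_congr rfl fun z _ => ?_
        rw [Matrix.map_apply, PowerSeries.coeff_C_mul, PowerSeries.coeff_mk]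
    have hadj : (φ M.det) • G = φ.mapMatrix M.adjugate := by
      rw [RingHom.map_det, RingHom.map_adjugate]
      calc _ = ((φ.mapMatrix M).adjugate * φ.mapMatrix M) * G := by
            rw [Matrix.adjugate_mul, Matrix.smul_mul, one_mul]
        _ = _ := by rw [mul_assoc, hMG, mul_one]
    refine ⟨∑ x, ∑ y, M.adjugate x y, M.det, ?_, ?_⟩
    · intro h0
      have h1 := congrArg Matrix.det hMG
      rw [Matrix.det_mul, ← RingHom.map_det, h0, map_zero, zero_mul, Matrix.det_one] at h1
      exact zero_ne_one h1
    · have hz : zetaSeries P = ∑ x, ∑ y, G x y := by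
        ext n
        simp only [zetaSeries, G, PowerSeries.coeff_mk, map_sum, card_chain_eq P n]
      change φ M.det * _ = φ (∑ x, ∑ y, M.adjugate x y)
      rw [hz, Finset.mul_sum, map_sum]
      refine Finset.sum_congr rfl fun x _ => ?_
      rw [Finset.mul_sum, map_sum]
      refine Finset.sum_congr rfl fun y _ => ?_
      exact congrFun (congrFun hadj x) y
  have hex : algebraMap (RatFunc ℂ) (LaurentSeries ℂ) (algebraMap _ _ p / algebraMap _ _ q)
      = (zetaSeries P : LaurentSeries ℂ) := by
    have hq' : algebraMap (RatFunc ℂ) (LaurentSeries ℂ) (algebraMap _ _ q) ≠ 0 := by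
      rw [map_ne_zero]
      exact RatFunc.algebraMap_ne_zero hq
    rw [map_div₀, div_eq_iff hq']
    have := congrArg (fun f : PowerSeries ℂ => (f : LaurentSeries ℂ)) hpq
    simp only [PowerSeries.coe_mul, RatFunc.coe_coe] at this
    rw [mul_comm]
    exact this.symm
  exact ⟨_, hex, fun R hR => (algebraMap (RatFunc ℂ) (LaurentSeries ℂ)).injective (hR.trans hex.symm)⟩

/-- The zeta series of a finite poset, as a rational function on the complex plane. -/
noncomputable def zeta : RatFunc ℂ := (existsUnique_zeta P).choose

theorem zeta_spec :
    algebraMap (RatFunc ℂ) (LaurentSeries ℂ) (zeta P) = (zetaSeries P : LaurentSeries ℂ) :=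
  (existsUnique_zeta P).choose_spec.1

/-- The multiset of complex zeros, with multiplicity, of the zeta series of a finite poset: the
zeros of the numerator in lowest terms. -/
noncomputable def zetaZeros : Multiset ℂ := (zeta P).num.roots

end Zeta

section Numbers

/-- `f_{i,d}`: the number of nondegenerate chains of length `i` in the barycentric subdivision
whose target is a given chain with `d + 1` elements. Everything below such a chain is a nonempty
subset of it, so the chain is taken to be `{0, …, d}` itself. -/
noncomputable def f (i d : ℕ) : ℕ :=
  Nat.card {c : Fin (i + 1) → Finset (Fin (d + 1)) //
    StrictMono c ∧ (∀ m, (c m).Nonempty) ∧ c (Fin.last i) = Finset.univ}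

/-- `F_{i,d}`: for `i < d` the sum over all `ℓ ≥ 0` and all
`i = i₀ < i₁ < ⋯ < i_ℓ < i_{ℓ+1} = d` of the product over `0 ≤ m ≤ ℓ` of
`f_{i_m, i_{m+1}} / ((d+1)! - (i_m + 1)!)`; and `F_{d,d} = 1`. There is no such tuple with
`ℓ ≥ d`, so `ℓ` ranges over `{0, …, d - 1}`. -/
noncomputable def F (i d : ℕ) : ℚ :=
  if i = d then 1 else
    ∑ l ∈ Finset.range d,
      ∑ c : {c : Fin (l + 2) → Fin (d + 1) //
          StrictMono c ∧ (c 0 : ℕ) = i ∧ (c (Fin.last (l + 1)) : ℕ) = d},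
        ∏ m : Fin (l + 1),
          (f (c.1 m.castSucc) (c.1 m.succ) : ℚ) /
            (((d + 1).factorial : ℚ) - (((c.1 m.castSucc : ℕ) + 1).factorial : ℚ))

/-- The polynomial `F_d(s) = ∑_{i=-1}^{d} F_{i,d} s^{d-i}`; the term `i = -1` is absent because
`F_{-1,d} = 0`. -/
noncomputable def Fpoly (d : ℕ) : Polynomial ℚ :=
  ∑ i ∈ Finset.range (d + 1), Polynomial.C (F i d) * Polynomial.X ^ (d - i)

/-- `H_{i,d}`: the coefficient of `(s+1)^i` in the expansion of `F_d(s)` at `s = -1`. -/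
noncomputable def H (i d : ℕ) : ℚ := (Polynomial.taylor (-1) (Fpoly d)).coeff i

end Numbers

end PosetZeta

/-! Let `c_i` be the number of nondegenerate chains of length `i`. Splitting `≤` into `<` and
equality gives `#N_n = ∑ C(n,i) c_i`, so `Z_P(s) = p(s) / (1-s)^(d+1)` with `p = ∑ c_i s^i
(1-s)^(d-i)`. Since `p(1) = c_d ≠ 0`, the fraction is reduced and the zeros of `Z_P` are the roots
of `p` (`zetaZeros_eq_roots`). The coefficient of `s^d` in `p` is `(-1)^d χ(P)`.

Subdivision acts on `(c_0, …, c_d)` by the triangular matrix of the `f_{j,i}`, the number of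
surjections from `i+1` points onto `j+1` points, with diagonal entries `(j+1)!`. It preserves `χ`,
and `c_j` of the `k`-th subdivision, divided by `(d+1)!^k`, tends to `c_d F_{j,d}`: the `F_{j,d}`
form the eigenvector for `(d+1)!` (`tendsto_numChains_iterSd`). Thus the numerators have a constant
leading coefficient, while their other coefficients are `O((d+1)!^k)`, the one of `s^(d-1)` having
the limit `c_d H_{1,d}` after scaling. If this limit is nonzero, the sum of the roots forces `|β_1|`
to infinity, and the equation of `β_1` divided by `β_1^(d-1)` leaves only its top two terms in the
limit (`tendsto_norm_largest_root`).

It remains to show `H_{1,d} ≠ 0`. The operator `X^k ↦ C(X,k)` is inverse to the surjection matrix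
and commutes with `X ↦ -1-X`. Its eigenvector `q = ∑ F_{i,d} X^(i+1)` therefore satisfies `q(-1-X) =
(-1)^(d+1) q(X)` (`limitPoly_comp`). The value and the derivative of this identity at `0` give
`H_{1,d} = F_{0,d}`, which is positive. -/

namespace PosetZeta

/-! ### Transfer matrices for counting paths -/

section Paths

open Matrix

theorem sum_paths {α R : Type*} [Fintype α] [DecidableEq α] [CommSemiring R] (W : Matrix α α R)
    (n : ℕ) (u v : α → R) :
    ∑ g : Fin (n + 1) → α,
        u (g 0) * (∏ i : Fin n, W (g i.castSucc) (g i.succ)) * v (g (Fin.last n))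
      = u ⬝ᵥ (W ^ n *ᵥ v) := by
  induction n generalizing u with
  | zero =>
    rw [← (Equiv.funUnique (Fin 1) α).symm.sum_comp]
    simp [dotProduct]
  | succ n ih =>
    rw [← (Fin.consEquiv fun _ => α).sum_comp, Fintype.sum_prod_type, Finset.sum_comm]
    rw [pow_succ', ← mulVec_mulVec, dotProduct_mulVec, ← ih]
    refine Finset.sum_congr rfl fun g _ => ?_
    simp only [vecMul, dotProduct, Finset.sum_mul]
    refine Finset.sum_congr rfl fun x _ => ?_
    rw [Fin.prod_univ_succ, ← Fin.succ_last]
    simp [Fin.consEquiv, mul_assoc]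

open Classical in
/-- The `0`-`1` matrix of a relation. -/
noncomputable def relMat {α : Type*} (r : α → α → Prop) : Matrix α α ℕ :=
  fun x y => if r x y then 1 else 0

open Classical in
theorem card_paths {α : Type*} [Fintype α] (r : α → α → Prop) (S : α → Prop) (n : ℕ) :
    Nat.card {g : Fin (n + 1) → α // (∀ i : Fin n, r (g i.castSucc) (g i.succ)) ∧
        S (g (Fin.last n))}
      = 1 ⬝ᵥ (relMat r ^ n *ᵥ fun x => if S x then 1 else 0) := by
  rw [← sum_paths, Nat.card_eq_fintype_card, Fintype.card_subtype, Finset.card_filter]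
  refine Finset.sum_congr rfl fun g _ => ?_
  simp only [relMat, Pi.one_apply, one_mul]
  by_cases h : ∀ i : Fin n, r (g i.castSucc) (g i.succ)
  · rw [Finset.prod_eq_one fun i _ => if_pos (h i)]
    simp [h]
  · rw [if_neg fun h' => h h'.1]
    push Not at h
    obtain ⟨i, hi⟩ := h
    rw [Finset.prod_eq_zero (Finset.mem_univ i) (if_neg hi), zero_mul]

end Paths

/-! ### Chains and nondegenerate chains -/

section Counting

open Matrix

variable (P : Type*) [PartialOrder P]

/-- The number of nondegenerate chains of length `i`. -/
noncomputable def numChains (i : ℕ) : ℕ := Nat.card (NondegChain P i)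

/-- The number of nondegenerate chains of length `i` with greatest element `x`. -/
noncomputable def numChainsTo (i : ℕ) (x : P) : ℕ :=
  Nat.card {c : Fin (i + 1) → P // StrictMono c ∧ c (Fin.last i) = x}

open Classical in
theorem numChainsTo_eq [Fintype P] (i : ℕ) (x : P) :
    numChainsTo P i x = ∑ y, (relMat (α := P) (· < ·) ^ i) y x := by
  have h := card_paths (α := P) (· < ·) (· = x) i
  simp only [← Fin.strictMono_iff_lt_succ] at h
  rw [numChainsTo, h]
  simp [dotProduct, mulVec]

theorem numChainsTo_zero [Fintype P] (x : P) : numChainsTo P 0 x = 1 := by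
  classical
  rw [numChainsTo_eq]
  simp [one_apply]

open Classical in
theorem numChainsTo_succ [Fintype P] (i : ℕ) (x : P) :
    numChainsTo P (i + 1) x = ∑ y with y < x, numChainsTo P i y := by
  simp only [numChainsTo_eq, pow_succ, mul_apply]
  rw [Finset.sum_comm, Finset.sum_filter]
  refine Finset.sum_congr rfl fun y _ => ?_
  rw [← Finset.sum_mul]
  simp [relMat]

open Classical in
theorem numChains_eq_sum_relMat [Fintype P] (i : ℕ) :
    numChains P i = 1 ⬝ᵥ (relMat (α := P) (· < ·) ^ i *ᵥ 1) := by
  have h := card_paths (α := P) (· < ·) (fun _ => True) i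
  simp only [← Fin.strictMono_iff_lt_succ, and_true, if_true] at h
  exact h

theorem numChains_eq_sum [Fintype P] (i : ℕ) : numChains P i = ∑ x, numChainsTo P i x := by
  classical
  rw [numChains_eq_sum_relMat]
  simp only [numChainsTo_eq]
  rw [Finset.sum_comm]
  simp [dotProduct, mulVec]

/-- Every chain is a degeneracy of a unique nondegenerate one. -/
theorem card_chain_eq_sum [Finite P] (n : ℕ) :
    Nat.card (Chain P n) = ∑ i ∈ Finset.range (n + 1), n.choose i * numChains P i := by
  classical
  have : Fintype P := Fintype.ofFinite P
  have h := card_paths (α := P) (· ≤ ·) (fun _ => True) n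
  simp only [← Fin.monotone_iff_le_succ, and_true, if_true] at h
  -- The identity commutes with the strict matrix, so the binomial theorem expands the `n`-th power;
  -- the exponent of the strict matrix counts the nonidentity steps.
  have hM : relMat (α := P) (· ≤ ·) = relMat (· < ·) + 1 := by
    ext x y
    by_cases hxy : x = y
    · simp [relMat, hxy]
    · simp [relMat, one_apply, hxy, le_iff_lt_or_eq]
  rw [Chain, h, hM, (Commute.one_right _).add_pow]
  simp only [numChains_eq_sum_relMat, one_pow, mul_one, sum_mulVec, dotProduct_sum]
  refine Finset.sum_congr rfl fun i _ => ?_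
  rw [← Nat.cast_comm, ← nsmul_eq_mul, smul_mulVec, dotProduct_smul]
  rfl

end Counting

/-! ### Surjection numbers -/

section Surjections

/-- The number of surjections from a set with `n` elements onto a set with `k` elements. -/
def surjCount : ℕ → ℕ → ℕ
  | 0, n => if n = 0 then 1 else 0
  | k + 1, n => ∑ m ∈ Finset.range n, n.choose m * surjCount k m

theorem surjCount_zero (n : ℕ) : surjCount 0 n = if n = 0 then 1 else 0 := rfl

theorem surjCount_succ (k n : ℕ) :
    surjCount (k + 1) n = ∑ m ∈ Finset.range n, n.choose m * surjCount k m := rfl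

theorem surjCount_eq_zero_of_lt {k n : ℕ} (h : n < k) : surjCount k n = 0 := by
  induction k generalizing n with
  | zero => omega
  | succ k ih =>
    rw [surjCount_succ]
    refine Finset.sum_eq_zero fun m hm => ?_
    rw [ih (by rw [Finset.mem_range] at hm; omega), mul_zero]

theorem surjCount_self (n : ℕ) : surjCount n n = n.factorial := by
  induction n with
  | zero => rfl
  | succ n ih =>
    rw [surjCount_succ, Finset.sum_range_succ, Finset.sum_eq_zero, ih, zero_add,
      Nat.choose_succ_self_right, Nat.factorial_succ]
    intro m hm
    rw [surjCount_eq_zero_of_lt (Finset.mem_range.1 hm), mul_zero]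

theorem surjCount_one {n : ℕ} (hn : n ≠ 0) : surjCount 1 n = 1 := by
  rw [surjCount_succ, Finset.sum_eq_single 0]
  · simp [surjCount_zero]
  · intro m _ hm
    simp [surjCount_zero, hm]
  · intro h
    simp at h
    omega

/-- Maps from `n` points to `x` points are sorted by their image. The proof is by induction on `x`,
expanding `(x + 1) ^ n` and matching it with Pascal's rule. -/
theorem pow_eq_sum_surjCount_mul_choose (x n N : ℕ) (hN : n < N) :
    x ^ n = ∑ k ∈ Finset.range N, surjCount k n * x.choose k := by
  induction x generalizing n N with
  | zero =>
    obtain ⟨N, rfl⟩ : ∃ M, N = M + 1 := ⟨N - 1, by omega⟩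
    rw [Finset.sum_range_succ']
    rcases n with _ | n <;> simp [surjCount_zero]
  | succ x ih =>
    obtain ⟨N, rfl⟩ : ∃ M, N = M + 1 := ⟨N - 1, by omega⟩
    have h1 : ∑ m ∈ Finset.range n, n.choose m * x ^ m
        = ∑ k ∈ Finset.range N, surjCount (k + 1) n * x.choose k := by
      simp only [surjCount_succ, Finset.sum_mul]
      rw [Finset.sum_comm]
      refine Finset.sum_congr rfl fun m hm => ?_
      rw [Finset.mem_range] at hm
      rw [ih m N (by omega), Finset.mul_sum]
      simp only [mul_assoc]
    rw [add_pow, Finset.sum_range_succ]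
    simp only [one_pow, mul_one, Nat.choose_self]
    simp only [mul_comm (x ^ _)]
    push_cast
    rw [h1, one_mul, ih n (N + 1) hN, Finset.sum_range_succ' _ N, Finset.sum_range_succ' _ N, ← add_assoc,
      ← Finset.sum_add_distrib]
    simp only [Nat.choose_succ_succ, Nat.choose_zero_right, mul_add]

end Surjections

/-! ### Chain counts of the barycentric subdivision -/

section Subdivision

open Classical in
theorem sum_ssubsets_apply_card {α : Type*} (s : Finset α) (g : ℕ → ℕ) :
    ∑ t ∈ s.ssubsets, g t.card = ∑ m ∈ Finset.range s.card, s.card.choose m * g m := by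
  have h := Finset.sum_powerset_apply_card g (x := s)
  rw [Finset.sum_range_succ, ← Finset.insert_erase (Finset.mem_powerset_self s),
    Finset.sum_insert (Finset.notMem_erase _ _), ← Finset.ssubsets] at h
  simp only [Nat.choose_self, smul_eq_mul] at h
  omega

/-- Every nonempty subset of a chain is a chain, so only the cardinality of `A` matters. Removing
the top of a flag gives the recursion that defines `surjCount`; the empty subset, which is not in
the subdivision, contributes zero. -/
theorem numChainsTo_sdCarrier (P : Type*) [PartialOrder P] [Finite P] (i : ℕ)
    (A : SdCarrier P) : numChainsTo (SdCarrier P) i A = surjCount (i + 1) A.1.card := by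
  classical
  have : Fintype P := Fintype.ofFinite P
  have : Fintype (SdCarrier P) := Fintype.ofFinite _
  induction i generalizing A with
  | zero => rw [numChainsTo_zero, surjCount_one (Finset.card_ne_zero.2 A.2.1)]
  | succ i ih =>
    rw [numChainsTo_succ, surjCount_succ, ← sum_ssubsets_apply_card]
    simp only [ih]
    trans ∑ t ∈ (Finset.univ.filter (· < A)).map (Function.Embedding.subtype _),
      surjCount (i + 1) t.card
    · rw [Finset.sum_map]
      congr!
    refine Finset.sum_subset ?_ ?_
    · intro t ht
      obtain ⟨B, hB, rfl⟩ := Finset.mem_map.1 ht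
      exact Finset.mem_ssubsets.2 (Finset.mem_filter.1 hB).2
    · intro t ht ht'
      rw [Finset.mem_ssubsets] at ht
      rcases t.eq_empty_or_nonempty with rfl | hne
      · exact surjCount_eq_zero_of_lt (by simp)
      · refine absurd ?_ ht'
        exact Finset.mem_map.2 ⟨⟨t, hne, A.2.2.mono (Finset.coe_subset.2 ht.subset)⟩,
          Finset.mem_filter.2 ⟨Finset.mem_univ _, ht⟩, rfl⟩

theorem card_sdCarrier_filter (P : Type*) [PartialOrder P] [Finite P] (i : ℕ) :
    Nat.card {A : SdCarrier P // A.1.card = i + 1} = numChains P i := by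
  classical
  symm
  refine Nat.card_congr (Equiv.ofBijective (fun c => ⟨⟨Finset.univ.image c.1, ?_, ?_⟩, ?_⟩) ⟨?_, ?_⟩)
  · simp
  · rw [Finset.coe_image, Finset.coe_univ, Set.image_univ]
    exact c.2.monotone.isChain_range
  · simp [Finset.card_image_of_injective _ c.2.injective]
  · intro c c' h
    simp only [Subtype.mk.injEq] at h
    have h' := congrArg (fun s : Finset P => (s : Set P)) h
    simp only [Finset.coe_image, Finset.coe_univ, Set.image_univ] at h'
    exact Subtype.ext ((StrictMono.range_inj c.2 c'.2).1 h')
  · rintro ⟨⟨A, hA, hc⟩, hcard⟩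
    let : LinearOrder A :=
      { (inferInstance : PartialOrder A) with
        le_total := fun a b => hc.total a.2 b.2
        toDecidableLE := Classical.decRel _ }
    have e := monoEquivOfFin A (k := i + 1) (by simpa using hcard)
    refine ⟨⟨fun m => (e m : P), fun a b hab => e.strictMono hab⟩, ?_⟩
    simp only [Subtype.mk.injEq]
    ext x
    simp only [Finset.mem_image, Finset.mem_univ, true_and]
    constructor
    · rintro ⟨a, rfl⟩
      exact (e a).2
    · intro hx
      exact ⟨e.symm ⟨x, hx⟩, by simp⟩

theorem numChains_sdCarrier (P : Type*) [PartialOrder P] [Finite P] (N : ℕ)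
    (hN : ∀ i, N ≤ i → numChains P i = 0) (j : ℕ) :
    numChains (SdCarrier P) j
      = ∑ i ∈ Finset.range N, surjCount (j + 1) (i + 1) * numChains P i := by
  classical
  have : Fintype P := Fintype.ofFinite P
  have : Fintype (SdCarrier P) := Fintype.ofFinite _
  rw [numChains_eq_sum]
  simp only [numChainsTo_sdCarrier]
  -- Flags are grouped by the length `card - 1` of their top chain; the subtraction is exact because
  -- that chain is nonempty.
  have hmaps : ∀ A ∈ (Finset.univ : Finset (SdCarrier P)), A.1.card - 1 ∈ Finset.range N := by
    intro A _
    by_contra h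
    rw [Finset.mem_range, not_lt] at h
    have h1 := hN _ h
    rw [← card_sdCarrier_filter, Nat.sub_add_cancel (Finset.card_pos.2 A.2.1)] at h1
    have : Nonempty {B : SdCarrier P // B.1.card = A.1.card} := ⟨⟨A, rfl⟩⟩
    exact Nat.card_pos.ne' h1
  rw [← Finset.sum_fiberwise_of_maps_to hmaps]
  refine Finset.sum_congr rfl fun i _ => ?_
  have hiff : ∀ A : SdCarrier P, A.1.card - 1 = i ↔ A.1.card = i + 1 := fun A => by
    have := Finset.card_pos.2 A.2.1
    omega
  rw [Finset.sum_congr rfl fun A hA => by rw [(hiff A).1 (Finset.mem_filter.1 hA).2],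
    Finset.sum_const, ← card_sdCarrier_filter, Nat.card_eq_fintype_card, Fintype.card_subtype,
    smul_eq_mul, mul_comm]
  simp only [hiff]

theorem f_eq_surjCount (i d : ℕ) : f i d = surjCount (i + 1) (d + 1) := by
  have hch : ∀ s : Finset (Fin (d + 1)), IsChain (· ≤ ·) (s : Set (Fin (d + 1))) :=
    fun s a _ b _ _ => le_total a b
  let A : SdCarrier (Fin (d + 1)) := ⟨Finset.univ, Finset.univ_nonempty, hch _⟩
  have h := numChainsTo_sdCarrier (Fin (d + 1)) i A
  rw [show A.1.card = d + 1 by simp [A]] at h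
  rw [← h]
  exact Nat.card_congr
    { toFun := fun c => ⟨fun m => ⟨c.1 m, c.2.2.1 m, hch _⟩, fun a b hab => c.2.1 hab,
        Subtype.ext c.2.2.2⟩
      invFun := fun c => ⟨fun m => (c.1 m).1, fun a b hab => c.2.1 hab, fun m => (c.1 m).2.1,
        congrArg Subtype.val c.2.2⟩
      left_inv := fun _ => rfl
      right_inv := fun _ => rfl }

end Subdivision

/-! ### The numerator polynomial -/

section Numerator

open Polynomial

/-- The polynomial `∑ c_i s^i (1 - s)^(d - i)`. -/
noncomputable def numerPoly (c : ℕ → ℂ) (d : ℕ) : ℂ[X] :=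
  ∑ i ∈ Finset.range (d + 1), C (c i) * (X ^ i * (1 - X) ^ (d - i))

theorem eval_one_numerPoly (c : ℕ → ℂ) (d : ℕ) : (numerPoly c d).eval 1 = c d := by
  rw [numerPoly, eval_finsetSum, Finset.sum_range_succ, Finset.sum_eq_zero]
  · simp
  · intro i hi
    rw [Finset.mem_range] at hi
    simp [Nat.sub_ne_zero_of_lt hi]

theorem coeff_one_sub_X_pow (n m : ℕ) :
    ((1 - X : ℂ[X]) ^ n).coeff m = (-1) ^ m * n.choose m := by
  have h : (1 - X : ℂ[X]) ^ n = ((1 + X) ^ n).comp (C (-1) * X) := by simp [sub_eq_add_neg]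
  rw [h, comp_C_mul_X_coeff, coeff_one_add_X_pow, mul_comm]

theorem coeff_numerPoly (c : ℕ → ℂ) (d j : ℕ) :
    (numerPoly c d).coeff j = ∑ i ∈ Finset.range (d + 1),
      c i * if i ≤ j then (-1) ^ (j - i) * ((d - i).choose (j - i) : ℂ) else 0 := by
  rw [numerPoly, finsetSum_coeff]
  refine Finset.sum_congr rfl fun i _ => ?_
  rw [coeff_C_mul, coeff_X_pow_mul', coeff_one_sub_X_pow]

theorem natDegree_numerPoly_le (c : ℕ → ℂ) (d : ℕ) : (numerPoly c d).natDegree ≤ d := by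
  rw [natDegree_le_iff_coeff_eq_zero]
  intro j hj
  rw [coeff_numerPoly]
  refine Finset.sum_eq_zero fun i hi => ?_
  rw [Finset.mem_range] at hi
  rw [if_pos (by omega), Nat.choose_eq_zero_of_lt (by omega)]
  simp

theorem coeff_numerPoly_self (c : ℕ → ℂ) (d : ℕ) :
    (numerPoly c d).coeff d = (-1) ^ d * ∑ i ∈ Finset.range (d + 1), (-1) ^ i * c i := by
  rw [coeff_numerPoly, Finset.mul_sum]
  refine Finset.sum_congr rfl fun i hi => ?_
  rw [Finset.mem_range] at hi
  obtain ⟨e, rfl⟩ := Nat.exists_eq_add_of_le (Nat.lt_succ_iff.1 hi)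
  rw [if_pos (by omega), Nat.choose_self, Nat.add_sub_cancel_left]
  have : ((-1 : ℂ) ^ i) * (-1) ^ i = 1 := by rw [← mul_pow]; simp
  linear_combination (-(-1) ^ e * c i) * this

end Numerator

/-! ### The zeta function as a reduced fraction -/

section ZetaFunction

open scoped RatFunc

variable (P : Type*) [PartialOrder P] [Finite P]

theorem mk_choose_mul_one_sub_pow (i d : ℕ) (hi : i ≤ d) :
    (PowerSeries.mk fun n => (n.choose i : ℂ)) * (1 - PowerSeries.X) ^ (d + 1)
      = PowerSeries.X ^ i * (1 - PowerSeries.X) ^ (d - i) := by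
  have h : (PowerSeries.mk fun n => (n.choose i : ℂ))
      = PowerSeries.X ^ i * PowerSeries.mk fun n => ((i + n).choose i : ℂ) := by
    ext n
    rw [PowerSeries.coeff_X_pow_mul', PowerSeries.coeff_mk]
    split_ifs with hn
    · rw [PowerSeries.coeff_mk, Nat.add_sub_cancel' hn]
    · rw [Nat.choose_eq_zero_of_lt (by omega), Nat.cast_zero]
  rw [h, show d + 1 = (i + 1) + (d - i) by omega, pow_add, mul_assoc, ← mul_assoc (PowerSeries.mk _),
    PowerSeries.mk_add_choose_mul_one_sub_pow_eq_one, one_mul]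

theorem zetaSeries_mul_one_sub_pow (d : ℕ) (hd : ∀ i, d < i → numChains P i = 0) :
    zetaSeries P * (1 - PowerSeries.X) ^ (d + 1)
      = (numerPoly (fun i => (numChains P i : ℂ)) d : PowerSeries ℂ) := by
  have h : zetaSeries P = ∑ i ∈ Finset.range (d + 1), PowerSeries.C (numChains P i : ℂ) *
      PowerSeries.mk fun n => (n.choose i : ℂ) := by
    ext n
    rw [zetaSeries, PowerSeries.coeff_mk, card_chain_eq_sum, map_sum]
    simp only [PowerSeries.coeff_C_mul, PowerSeries.coeff_mk]
    push_cast
    -- Both truncations equal the sum over a common longer range: binomials vanish beyond `n`, chain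
    -- numbers beyond `d`.
    have h1 : ∀ N, N = n ∨ N = d → ∑ i ∈ Finset.range (N + 1),
        (n.choose i : ℂ) * numChains P i
          = ∑ i ∈ Finset.range (n + d + 1), (n.choose i : ℂ) * numChains P i := by
      intro N hN
      refine Finset.sum_subset (Finset.range_mono (by omega)) fun i _ hi => ?_
      rw [Finset.mem_range, not_lt] at hi
      rcases hN with rfl | rfl
      · rw [Nat.choose_eq_zero_of_lt (by omega)]
        simp
      · rw [hd i (by omega)]
        simp
    rw [h1 n (.inl rfl), ← h1 d (.inr rfl)]
    exact Finset.sum_congr rfl fun i _ => mul_comm _ _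
  rw [h, Finset.sum_mul, numerPoly, ← Polynomial.coeToPowerSeries.ringHom_apply, map_sum]
  refine Finset.sum_congr rfl fun i hi => ?_
  rw [mul_assoc, mk_choose_mul_one_sub_pow i d (by rw [Finset.mem_range] at hi; omega)]
  simp only [map_mul, map_pow, map_sub, map_one, Polynomial.coeToPowerSeries.ringHom_apply,
    Polynomial.coe_C, Polynomial.coe_X]

theorem zetaZeros_eq_roots (d : ℕ) (hd : ∀ i, d < i → numChains P i = 0)
    (h0 : numChains P d ≠ 0) :
    zetaZeros P = (numerPoly (fun i => (numChains P i : ℂ)) d).roots := by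
  set p := numerPoly (fun i => (numChains P i : ℂ)) d with hp
  set q : Polynomial ℂ := (1 - Polynomial.X) ^ (d + 1) with hq
  have hq0 : q ≠ 0 := pow_ne_zero _ fun h => by
    simpa using congrArg (Polynomial.eval 0) h
  have hz : zeta P = algebraMap _ _ p / algebraMap _ _ q := by
    apply (algebraMap (RatFunc ℂ) (LaurentSeries ℂ)).injective
    have hq' : algebraMap (RatFunc ℂ) (LaurentSeries ℂ) (algebraMap _ _ q) ≠ 0 := by
      rw [map_ne_zero]
      exact RatFunc.algebraMap_ne_zero hq0
    rw [zeta_spec, map_div₀, eq_div_iff hq']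
    have := congrArg (fun f : PowerSeries ℂ => (f : LaurentSeries ℂ))
      (zetaSeries_mul_one_sub_pow P d hd)
    have hqs : ((1 - PowerSeries.X : PowerSeries ℂ)) ^ (d + 1) = (q : PowerSeries ℂ) := by
      simp [hq]
    rw [hqs] at this
    simp only [PowerSeries.coe_mul, RatFunc.coe_coe] at this
    exact this
  have hcop : IsCoprime p q := by
    refine IsCoprime.pow_right ?_
    have hirr : Irreducible (Polynomial.X - Polynomial.C (1 : ℂ)) := Polynomial.irreducible_X_sub_C 1
    have : IsCoprime (Polynomial.X - Polynomial.C (1 : ℂ)) p := by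
      rw [hirr.coprime_iff_not_dvd, Polynomial.dvd_iff_isRoot, Polynomial.IsRoot.def, hp,
        eval_one_numerPoly]
      exact_mod_cast h0
    have h' := this.symm.neg_right
    rwa [neg_sub, Polynomial.C_1] at h'
  have hmul : (zeta P).num * q = p * (zeta P).denom :=
    (RatFunc.num_mul_eq_mul_denom_iff hq0).2 hz
  have h1 : (zeta P).num ∣ p :=
    (RatFunc.isCoprime_num_denom _).dvd_of_dvd_mul_right (hmul ▸ Dvd.intro _ rfl)
  have h2 : p ∣ (zeta P).num := hcop.dvd_of_dvd_mul_right (hmul ▸ Dvd.intro _ rfl)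
  obtain ⟨u, hu⟩ := associated_of_dvd_dvd h2 h1
  obtain ⟨r, hr, hru⟩ := Polynomial.isUnit_iff.1 u.isUnit
  rw [zetaZeros, ← hu, ← hru, mul_comm, Polynomial.roots_C_mul _ hr.ne_zero]

end ZetaFunction

/-! ### The Newton basis and its reflection symmetry -/

section Newton

open Polynomial

theorem eq_of_eval_natCast_eq {p q : ℚ[X]} (h : ∀ n : ℕ, p.eval (n : ℚ) = q.eval (n : ℚ)) :
    p = q := by
  refine eq_of_infinite_eval_eq p q (Set.Infinite.mono ?_ (Set.infinite_range_of_injective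
    (Nat.cast_injective (R := ℚ))))
  rintro _ ⟨n, rfl⟩
  exact h n

/-- The Newton polynomial `X (X - 1) ⋯ (X - k + 1) / k!`. -/
noncomputable def newton (k : ℕ) : ℚ[X] := C ((k.factorial : ℚ)⁻¹) * descPochhammer ℚ k

theorem eval_newton_natCast (k n : ℕ) : (newton k).eval (n : ℚ) = n.choose k := by
  rw [newton, eval_C_mul, descPochhammer_eval_eq_descFactorial, Nat.descFactorial_eq_factorial_mul_choose]
  have := k.factorial_ne_zero
  push_cast
  field_simp

theorem eval_newton_neg (k n : ℕ) :
    (newton k).eval (-1 - (n : ℚ)) = (-1) ^ k * (n + k).choose k := by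
  have h := ascPochhammer_eval_neg_eq_descPochhammer ℚ (-1 - (n : ℚ)) k
  rw [show -(-1 - (n : ℚ)) = ((n + 1 : ℕ) : ℚ) by push_cast; ring,
    ascPochhammer_nat_eq_natCast_ascFactorial, Nat.ascFactorial_eq_factorial_mul_choose] at h
  have h1 : ((-1 : ℚ) ^ k) * (-1) ^ k = 1 := by rw [← mul_pow]; simp
  have h2 : (descPochhammer ℚ k).eval (-1 - (n : ℚ))
      = (-1) ^ k * (k.factorial * (n + k).choose k : ℕ) := by
    rw [h, ← mul_assoc, h1, one_mul]
  rw [newton, eval_C_mul, h2]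
  have := k.factorial_ne_zero
  push_cast
  field_simp

theorem coeff_newton_self (k : ℕ) : (newton k).coeff k = (k.factorial : ℚ)⁻¹ := by
  rw [newton, coeff_C_mul]
  have h := (monic_descPochhammer ℚ k).coeff_natDegree
  rw [descPochhammer_natDegree] at h
  rw [h, mul_one]

theorem natDegree_newton_le (k : ℕ) : (newton k).natDegree ≤ k :=
  (natDegree_C_mul_le _ _).trans (descPochhammer_natDegree ℚ k).le

/-- The linear map taking `X ^ k` to the Newton polynomial of degree `k`. -/
noncomputable def newtonMap : ℚ[X] →ₗ[ℚ] ℚ[X] := (basisMonomials ℚ).constr ℚ newton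

theorem newtonMap_X_pow (k : ℕ) : newtonMap (X ^ k) = newton k := by
  have h := (basisMonomials ℚ).constr_basis ℚ newton k
  simpa only [newtonMap, coe_basisMonomials, monomial_one_right_eq_X_pow] using h

theorem newtonMap_eq_sum {q : ℚ[X]} {N : ℕ} (hN : q.natDegree < N) :
    newtonMap q = ∑ k ∈ Finset.range N, q.coeff k • newton k := by
  conv_lhs => rw [q.as_sum_range' N hN, map_sum]
  refine Finset.sum_congr rfl fun k _ => ?_
  rw [← smul_X_eq_monomial, map_smul, newtonMap_X_pow]

theorem coeff_natDegree_newtonMap (q : ℚ[X]) :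
    (newtonMap q).coeff q.natDegree = q.leadingCoeff * (q.natDegree.factorial : ℚ)⁻¹ := by
  rw [newtonMap_eq_sum (Nat.lt_succ_self _), Finset.sum_range_succ, coeff_add, coeff_smul,
    coeff_newton_self, finsetSum_coeff, Finset.sum_eq_zero, zero_add]
  · rfl
  · intro k hk
    rw [coeff_smul, coeff_eq_zero_of_natDegree_lt (p := newton k), smul_zero]
    exact (natDegree_newton_le k).trans_lt (Finset.mem_range.1 hk)

/-- At a natural number `n`, upper negation turns the left side into `(-1)^k C(n+k,k)`, which
Vandermonde expands as `(-1)^k ∑ C(n,j) C(k,j)`. -/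
theorem newton_comp (k : ℕ) :
    (newton k).comp (-1 - X) = newtonMap ((-1 - X) ^ k) := by
  have h1 : ((-1 - X : ℚ[X]) ^ k)
      = ∑ j ∈ Finset.range (k + 1), ((-1) ^ k * (k.choose j : ℚ)) • X ^ j := by
    rw [show (-1 - X : ℚ[X]) = C (-1) * (X + 1) by simp; ring, mul_pow, add_pow, Finset.mul_sum]
    refine Finset.sum_congr rfl fun j _ => ?_
    rw [smul_eq_C_mul]
    simp
    ring
  rw [h1, map_sum]
  simp only [map_smul, newtonMap_X_pow]
  refine eq_of_eval_natCast_eq fun n => ?_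
  rw [eval_comp, eval_finsetSum]
  simp only [eval_smul, eval_newton_natCast, smul_eq_mul, eval_sub, eval_neg, eval_one, eval_X]
  rw [eval_newton_neg, Nat.add_choose_eq, Finset.Nat.sum_antidiagonal_eq_sum_range_succ_mk]
  push_cast
  rw [Finset.mul_sum]
  refine Finset.sum_congr rfl fun j hj => ?_
  rw [Finset.mem_range] at hj
  rw [Nat.choose_symm (by omega)]
  ring

theorem newtonMap_comp (q : ℚ[X]) :
    newtonMap (q.comp (-1 - X)) = (newtonMap q).comp (-1 - X) := by
  induction q using Polynomial.induction_on' with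
  | add p q hp hq => rw [add_comp, map_add, map_add, add_comp, hp, hq]
  | monomial k a =>
    rw [← smul_X_eq_monomial, smul_comp, map_smul, map_smul, smul_comp, newtonMap_X_pow,
      newton_comp, X_pow_comp]

theorem X_pow_eq_sum_newton {n N : ℕ} (h : n < N) :
    (X ^ n : ℚ[X]) = ∑ k ∈ Finset.range N, (surjCount k n : ℚ) • newton k := by
  refine eq_of_eval_natCast_eq fun x => ?_
  rw [eval_finsetSum]
  simp only [eval_smul, eval_newton_natCast, eval_pow, eval_X, smul_eq_mul]
  exact_mod_cast pow_eq_sum_surjCount_mul_choose x n N h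

/-- This is the Newton expansion of `X ^ n` at `-1`, where `newton k` takes the value `(-1)^k`. It
yields the invariance of the Euler characteristic under subdivision. -/
theorem sum_neg_one_pow_mul_surjCount {n N : ℕ} (h : n < N) :
    ∑ k ∈ Finset.range N, (-1) ^ k * (surjCount k n : ℤ) = (-1) ^ n := by
  have h0 : ∀ k, (newton k).eval (-1) = (-1) ^ k := fun k => by simpa using eval_newton_neg k 0
  have h1 := congrArg (Polynomial.eval (-1)) (X_pow_eq_sum_newton h)
  simp only [eval_finsetSum, eval_smul, h0, eval_pow, eval_X, smul_eq_mul] at h1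
  simp only [mul_comm ((-1) ^ _)]
  exact_mod_cast h1.symm

/-- The surjection matrix rewrites monomials in the Newton basis, so its eigenvectors are those of
`newtonMap` with the inverse eigenvalue. -/
theorem smul_newtonMap_eq_self {q : ℚ[X]} {N : ℕ} {t : ℚ} (hN : q.natDegree < N)
    (h : ∀ j < N, t * q.coeff j = ∑ i ∈ Finset.range N, surjCount j i * q.coeff i) :
    t • newtonMap q = q := by
  conv_rhs => rw [q.as_sum_range' N hN]
  rw [newtonMap_eq_sum hN, Finset.smul_sum]
  have h1 : ∀ i ∈ Finset.range N, monomial i (q.coeff i)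
      = ∑ k ∈ Finset.range N, ((surjCount k i : ℚ) * q.coeff i) • newton k := fun i hi => by
    rw [← smul_X_eq_monomial, X_pow_eq_sum_newton (Finset.mem_range.1 hi), Finset.smul_sum]
    simp only [smul_smul, mul_comm]
  rw [Finset.sum_congr rfl h1, Finset.sum_comm]
  refine Finset.sum_congr rfl fun j hj => ?_
  rw [smul_smul, h j (Finset.mem_range.1 hj), Finset.sum_smul]

/-- `newtonMap` divides the leading coefficient in degree `m` by `m!`, so an eigenvector of that
degree forces `t = m!`. -/
theorem eq_zero_of_smul_newtonMap_eq {q : ℚ[X]} {t : ℚ} (h : t • newtonMap q = q)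
    (ht : (q.natDegree.factorial : ℚ) ≠ t) : q = 0 := by
  by_contra hq
  have h1 := congrArg (fun p => coeff p q.natDegree) h
  simp only [coeff_smul, coeff_natDegree_newtonMap, smul_eq_mul, coeff_natDegree] at h1
  have h2 : q.leadingCoeff ≠ 0 := leadingCoeff_ne_zero.2 hq
  have h3 : (q.natDegree.factorial : ℚ) ≠ 0 := by exact_mod_cast q.natDegree.factorial_ne_zero
  field_simp at h1
  exact ht h1.symm

/-- The difference of the two sides satisfies the same eigenvector equation, but its terms of degree
`d + 1` cancel, so it must vanish. -/
theorem comp_eq_of_smul_newtonMap_eq {q : ℚ[X]} {d : ℕ} (hd : 1 ≤ d) (hdeg : q.natDegree = d + 1)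
    (h : ((d + 1).factorial : ℚ) • newtonMap q = q) :
    q.comp (-1 - X) = (-1) ^ (d + 1) * q := by
  have hdeg1 : (-1 - X : ℚ[X]).natDegree = 1 := by
    rw [show (-1 - X : ℚ[X]) = -(X + C 1) by simp; ring, natDegree_neg, natDegree_X_add_C]
  have hlc1 : (-1 - X : ℚ[X]).leadingCoeff = -1 := by
    rw [show (-1 - X : ℚ[X]) = -(X + C 1) by simp; ring, leadingCoeff_neg, leadingCoeff_X_add_C]
  have hC : (-1 : ℚ[X]) ^ (d + 1) * q = ((-1 : ℚ) ^ (d + 1)) • q := by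
    rw [smul_eq_C_mul]
    simp
  rw [← sub_eq_zero, hC]
  refine eq_zero_of_smul_newtonMap_eq (t := (d + 1).factorial) ?_ ?_
  · rw [map_sub, newtonMap_comp, map_smul, smul_sub, ← smul_comp, h, smul_comm, h]
  · have h1 : (q.comp (-1 - X) - ((-1 : ℚ) ^ (d + 1)) • q).natDegree ≤ d := by
      rw [natDegree_le_iff_coeff_eq_zero]
      intro m hm
      rcases eq_or_lt_of_le (Nat.succ_le_of_lt hm) with rfl | hm'
      · have h2 := coeff_comp_degree_mul_degree (p := q) (q := -1 - X) (by rw [hdeg1]; simp)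
        rw [hdeg, hdeg1, mul_one, hlc1] at h2
        rw [coeff_sub, coeff_smul, Nat.succ_eq_add_one, h2, leadingCoeff, hdeg, smul_eq_mul,
          mul_comm, sub_self]
      · rw [coeff_sub, coeff_smul, coeff_eq_zero_of_natDegree_lt (p := q) (by omega),
          coeff_eq_zero_of_natDegree_lt, smul_zero, sub_zero]
        rw [natDegree_comp, hdeg, hdeg1]
        omega
    -- Strictness of `d! < (d+1)!` needs `1 ≤ d`, since `0! = 1!`.
    have h2 := (Nat.factorial_le h1).trans_lt
      ((Nat.factorial_lt (by omega)).2 (Nat.lt_succ_self d))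
    exact_mod_cast h2.ne

end Newton

/-! ### The numbers `F_{i,d}` as an eigenvector -/

section Limit

open Matrix

theorem pow_apply_eq_zero_of_lt {n : ℕ} {W : Matrix (Fin n) (Fin n) ℚ}
    (hW : ∀ a b, b ≤ a → W a b = 0) (l : ℕ) {a b : Fin n} (h : (b : ℕ) < a + l) :
    (W ^ l) a b = 0 := by
  induction l generalizing a with
  | zero => rw [pow_zero, one_apply_ne]; rintro rfl; omega
  | succ l ih =>
    rw [pow_succ', mul_apply]
    refine Finset.sum_eq_zero fun c _ => ?_
    rcases le_or_gt c a with hc | hc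
    · rw [hW a c hc, zero_mul]
    · rw [ih (by have : (a : ℕ) < c := hc; omega), mul_zero]

/-- The matrix whose paths are summed by `F`. -/
noncomputable def stepMat (d : ℕ) : Matrix (Fin (d + 1)) (Fin (d + 1)) ℚ := fun a b =>
  if a < b then (f a b : ℚ) / (((d + 1).factorial : ℚ) - (((a : ℕ) + 1).factorial : ℚ)) else 0

theorem F_self (d : ℕ) : F d d = 1 := if_pos rfl

theorem F_eq_sum_stepMat {d : ℕ} (i : Fin (d + 1)) (hi : (i : ℕ) ≠ d) :
    F i d = ∑ l ∈ Finset.range d, (stepMat d ^ (l + 1)) i (Fin.last d) := by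
  classical
  rw [F, if_neg hi]
  refine Finset.sum_congr rfl fun l _ => ?_
  have h := sum_paths (stepMat d) (l + 1) (Pi.single i 1) (Pi.single (Fin.last d) 1)
  rw [single_one_dotProduct, mulVec_single_one, col_apply] at h
  rw [← h, ← Finset.sum_subtype (Finset.univ.filter fun c : Fin (l + 2) → Fin (d + 1) =>
      StrictMono c ∧ (c 0 : ℕ) = i ∧ (c (Fin.last (l + 1)) : ℕ) = d) (by simp)
    (fun c => ∏ m : Fin (l + 1), (f (c m.castSucc) (c m.succ) : ℚ) /
      (((d + 1).factorial : ℚ) - (((c m.castSucc : ℕ) + 1).factorial : ℚ))), Finset.sum_filter]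
  refine Finset.sum_congr rfl fun c _ => ?_
  by_cases h0 : c 0 = i
  · by_cases h1 : c (Fin.last (l + 1)) = Fin.last d
    · rw [h0, h1, Pi.single_eq_same, Pi.single_eq_same, one_mul, mul_one]
      by_cases h2 : StrictMono c
      · rw [if_pos ⟨h2, rfl, rfl⟩]
        exact Finset.prod_congr rfl fun m _ => (if_pos (h2 (Fin.castSucc_lt_succ))).symm
      · rw [if_neg fun h' => h2 h'.1]
        rw [Fin.strictMono_iff_lt_succ] at h2
        push Not at h2
        obtain ⟨m, hm⟩ := h2
        exact (Finset.prod_eq_zero (Finset.mem_univ m) (if_neg hm.not_gt)).symm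
    · rw [if_neg fun h' => h1 (Fin.ext h'.2.2), Pi.single_eq_of_ne h1, mul_zero]
  · rw [if_neg fun h' => h0 (Fin.ext h'.2.1), Pi.single_eq_of_ne h0, zero_mul, zero_mul]

theorem stepMat_eq_zero {d : ℕ} (a b : Fin (d + 1)) (h : b ≤ a) : stepMat d a b = 0 :=
  if_neg h.not_gt

/-- Compared with `F_eq_sum_stepMat` the lengths are shifted down by one. This is harmless for `a ≠
0`: no increasing path of length `d` from `a` fits, and length zero accounts for `F_{d,d} = 1`. -/
theorem sum_stepMat_pow {d : ℕ} (hd : 1 ≤ d) (a : Fin (d + 1)) (ha : (a : ℕ) ≠ 0) :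
    ∑ l ∈ Finset.range d, (stepMat d ^ l) a (Fin.last d) = F a d := by
  by_cases had : (a : ℕ) = d
  · obtain rfl : a = Fin.last d := Fin.ext had
    rw [Finset.sum_eq_single_of_mem 0 (by simp; omega), pow_zero, one_apply_eq, Fin.val_last, F_self]
    intro l _ hl
    exact pow_apply_eq_zero_of_lt stepMat_eq_zero l (by omega)
  · have hne : a ≠ Fin.last d := fun h => had (congrArg Fin.val h)
    have h1 := Finset.sum_range_succ (fun l => (stepMat d ^ l) a (Fin.last d)) d
    rw [Finset.sum_range_succ', pow_zero, one_apply_ne hne, ← F_eq_sum_stepMat a had,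
      pow_apply_eq_zero_of_lt stepMat_eq_zero d (by rw [Fin.val_last]; omega)] at h1
    linarith

theorem factorial_lt_factorial {i d : ℕ} (h : i < d) :
    ((i + 1).factorial : ℚ) < (d + 1).factorial := by
  exact_mod_cast (Nat.factorial_lt (Nat.succ_pos i)).2 (Nat.succ_lt_succ h)

/-- The first step is split off each path from `i` to `d`; its denominator depends only on `i`. -/
theorem F_mul_sub {i d : ℕ} (h : i < d) :
    F i d * (((d + 1).factorial : ℚ) - (i + 1).factorial)
      = ∑ j ∈ Finset.Ioc i d, (f i j : ℚ) * F j d := by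
  have hne := sub_ne_zero.2 (factorial_lt_factorial h).ne'
  have h1 := F_eq_sum_stepMat (⟨i, by omega⟩ : Fin (d + 1)) h.ne
  simp only [pow_succ', mul_apply] at h1
  rw [Finset.sum_comm] at h1
  rw [h1, Finset.sum_mul]
  have h2 : ∀ a : Fin (d + 1), (∑ l ∈ Finset.range d,
      stepMat d ⟨i, by omega⟩ a * (stepMat d ^ l) a (Fin.last d)) *
        (((d + 1).factorial : ℚ) - (i + 1).factorial)
      = (fun a : ℕ => if i < a then (f i a : ℚ) * F a d else 0) a := by
    intro a
    by_cases hia : i < a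
    · rw [← Finset.mul_sum, sum_stepMat_pow (by omega) a (by omega)]
      simp only [stepMat, Fin.lt_def, hia, if_true]
      field_simp
    · simp [stepMat, Fin.lt_def, hia]
  rw [Finset.sum_congr rfl fun a _ => h2 a, Fin.sum_univ_eq_sum_range
    (fun a : ℕ => if i < a then (f i a : ℚ) * F a d else 0), ← Finset.sum_filter]
  refine Finset.sum_congr ?_ fun _ _ => rfl
  ext j
  simp
  omega

theorem F_nonneg {i d : ℕ} (h : i ≤ d) : 0 ≤ F i d := by
  rcases eq_or_lt_of_le h with rfl | h
  · rw [F_self]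
    exact zero_le_one
  · rw [F, if_neg h.ne]
    refine Finset.sum_nonneg fun l _ => Finset.sum_nonneg fun c _ => Finset.prod_nonneg fun m _ => ?_
    refine div_nonneg (Nat.cast_nonneg _) (sub_nonneg.2 ?_)
    exact_mod_cast Nat.factorial_le (by omega)

theorem F_zero_pos {d : ℕ} (hd : 1 ≤ d) : 0 < F 0 d := by
  have h1 := F_mul_sub (i := 0) (d := d) (by omega)
  have h2 : (1 : ℚ) ≤ ∑ j ∈ Finset.Ioc 0 d, (f 0 j : ℚ) * F j d := by
    refine le_trans ?_ (Finset.single_le_sum (f := fun j => (f 0 j : ℚ) * F j d) (fun j hj => ?_)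
      (Finset.mem_Ioc.2 ⟨hd, le_refl d⟩))
    · simp [F_self, f_eq_surjCount, surjCount_one]
    · exact mul_nonneg (Nat.cast_nonneg _) (F_nonneg (Finset.mem_Ioc.1 hj).2)
  have h3 := sub_pos.2 (factorial_lt_factorial (i := 0) (d := d) (by omega))
  exact pos_of_mul_pos_left (h1 ▸ zero_lt_one.trans_le h2) h3.le

/-- `(F_{0,d}, …, F_{d,d})` is an eigenvector of the subdivision matrix. -/
theorem factorial_mul_F {j d : ℕ} (h : j ≤ d) :
    ((d + 1).factorial : ℚ) * F j d = ∑ i ∈ Finset.range (d + 1), (f j i : ℚ) * F i d := by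
  have hsub : Finset.Icc j d ⊆ Finset.range (d + 1) := fun i hi => by
    rw [Finset.mem_Icc] at hi
    rw [Finset.mem_range]
    omega
  rw [← Finset.sum_subset hsub, ← Finset.Ioc_insert_left h, Finset.sum_insert (by simp),
    f_eq_surjCount, surjCount_self]
  · rcases eq_or_lt_of_le h with rfl | h
    · simp
    · rw [← F_mul_sub h]
      ring
  · intro i hi hi'
    rw [Finset.mem_range] at hi
    rw [Finset.mem_Icc] at hi'
    rw [f_eq_surjCount, surjCount_eq_zero_of_lt (by omega), Nat.cast_zero, zero_mul]

end Limit

/-! ### Reflection symmetry and positivity of `H_{1,d}` -/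

section Symmetry

open Polynomial

/-- The polynomial `∑ F_{i,d} s^(i+1)`. -/
noncomputable def limitPoly (d : ℕ) : ℚ[X] :=
  ∑ i ∈ Finset.range (d + 1), C (F i d) * X ^ (i + 1)

theorem coeff_limitPoly_succ (d i : ℕ) :
    (limitPoly d).coeff (i + 1) = if i ≤ d then F i d else 0 := by
  simp [limitPoly, coeff_X_pow]

theorem coeff_limitPoly_zero (d : ℕ) : (limitPoly d).coeff 0 = 0 := by
  simp [limitPoly, coeff_X_pow]

theorem natDegree_limitPoly (d : ℕ) : (limitPoly d).natDegree = d + 1 := by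
  refine natDegree_eq_of_le_of_coeff_ne_zero ?_ ?_
  · rw [natDegree_le_iff_coeff_eq_zero]
    intro m hm
    obtain ⟨m, rfl⟩ : ∃ n, m = n + 1 := ⟨m - 1, by omega⟩
    rw [coeff_limitPoly_succ, if_neg (by omega)]
  · simp [coeff_limitPoly_succ, F_self]

theorem smul_newtonMap_limitPoly (d : ℕ) :
    ((d + 1).factorial : ℚ) • newtonMap (limitPoly d) = limitPoly d := by
  refine smul_newtonMap_eq_self (N := d + 2) (by rw [natDegree_limitPoly]; omega) fun j hj => ?_
  rw [Finset.sum_range_succ', coeff_limitPoly_zero, mul_zero, add_zero]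
  rcases j with _ | j
  · simp [coeff_limitPoly_zero, surjCount_zero]
  · rw [coeff_limitPoly_succ, if_pos (by omega), factorial_mul_F (by omega)]
    refine Finset.sum_congr rfl fun i hi => ?_
    rw [coeff_limitPoly_succ, if_pos (by rw [Finset.mem_range] at hi; omega), f_eq_surjCount]

theorem limitPoly_comp {d : ℕ} (hd : 1 ≤ d) :
    (limitPoly d).comp (-1 - X) = (-1) ^ (d + 1) * limitPoly d :=
  comp_eq_of_smul_newtonMap_eq hd (natDegree_limitPoly d) (smul_newtonMap_limitPoly d)

theorem sum_F_alternating {d : ℕ} (hd : 1 ≤ d) :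
    ∑ i ∈ Finset.range (d + 1), F i d * (-1) ^ i = 0 := by
  have h := congrArg (eval 0) (limitPoly_comp hd)
  rw [eval_mul, ← coeff_zero_eq_eval_zero (limitPoly d), coeff_limitPoly_zero, mul_zero,
    eval_comp] at h
  simp only [limitPoly, eval_finsetSum, eval_mul, eval_C, eval_pow, eval_X, eval_sub, eval_neg,
    eval_one, sub_zero, pow_succ, mul_neg, mul_one, Finset.sum_neg_distrib] at h
  linarith

theorem sum_F_mul_alternating {d : ℕ} (hd : 1 ≤ d) :
    ∑ i ∈ Finset.range (d + 1), F i d * ((i + 1) * (-1) ^ i) = (-1) ^ d * F 0 d := by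
  have h := congrArg (fun p => eval 0 (derivative p)) (limitPoly_comp hd)
  have hC : (-1 : ℚ[X]) ^ (d + 1) * limitPoly d = C ((-1) ^ (d + 1)) * limitPoly d := by simp
  have h0 : eval 0 (derivative (limitPoly d)) = F 0 d := by
    rw [← coeff_zero_eq_eval_zero, coeff_derivative, coeff_limitPoly_succ]
    simp
  rw [hC] at h
  simp only [derivative_C_mul, eval_mul, eval_C, h0, derivative_comp, eval_comp] at h
  simp [limitPoly, eval_finsetSum] at h
  rw [pow_succ] at h
  linarith

theorem H_one_eq_sum (d : ℕ) :
    H 1 d = ∑ i ∈ Finset.range (d + 1), F i d * (((d - i : ℕ) : ℚ) * (-1) ^ (d - i - 1)) := by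
  rw [H, taylor_coeff_one, Fpoly]
  simp [derivative_X_pow, eval_finsetSum]

/-- Writing `d - i = (d + 1) - (i + 1)` expresses `H 1 d` through the two alternating sums given by
the reflection. -/
theorem H_one_eq {d : ℕ} (hd : 1 ≤ d) : H 1 d = F 0 d := by
  have h2 : ∀ i ∈ Finset.range (d + 1), F i d * (((d - i : ℕ) : ℚ) * (-1) ^ (d - i - 1))
      = (-1) ^ d * (F i d * ((i + 1) * (-1) ^ i)) - (-1) ^ d * (d + 1) * (F i d * (-1) ^ i) := by
    intro i hi
    rw [Finset.mem_range] at hi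
    obtain ⟨e, rfl⟩ := Nat.exists_eq_add_of_le (Nat.lt_succ_iff.1 hi)
    have hs : ((-1 : ℚ) ^ i) * (-1) ^ i = 1 := by rw [← mul_pow]; simp
    rw [Nat.add_sub_cancel_left]
    push_cast
    -- For `e = 0` the exponent `d - i - 1` is truncated, but the factor `d - i` is zero.
    rcases e with _ | e
    · simp
      ring
    · rw [Nat.add_sub_cancel, pow_add, pow_succ]
      push_cast
      linear_combination (-F i (i + (e + 1)) * (e + 1) * (-1) ^ e) * hs
  rw [H_one_eq_sum, Finset.sum_congr rfl h2, Finset.sum_sub_distrib, ← Finset.mul_sum, ← Finset.mul_sum,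
    sum_F_alternating hd, sum_F_mul_alternating hd, mul_zero, sub_zero, ← mul_assoc, ← mul_pow]
  simp

theorem H_one_pos {d : ℕ} (hd : 1 ≤ d) : 0 < H 1 d := by
  rw [H_one_eq hd]
  exact F_zero_pos hd

end Symmetry

/-! ### Limits of recurrences and of the largest root -/

section Asymptotics

open Filter Topology

theorem tendsto_of_affine_recurrence {x w : ℕ → ℝ} {r l : ℝ} (hr0 : 0 ≤ r) (hr1 : r < 1)
    (hx : ∀ k, x (k + 1) = r * x k + w k) (hw : Tendsto w atTop (𝓝 ((1 - r) * l))) :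
    Tendsto x atTop (𝓝 l) := by
  have hr : 0 < 1 - r := sub_pos.2 hr1
  rw [Metric.tendsto_atTop] at hw ⊢
  intro ε hε
  -- With this tolerance `ε / 2` is a fixed point of the error recursion: `r * (ε / 2) + (1 - r) *
  -- (ε / 2) = ε / 2`.
  obtain ⟨K, hK⟩ := hw (ε / 2 * (1 - r)) (by positivity)
  have hbound : ∀ n, |x (K + n) - l| ≤ r ^ n * |x K - l| + ε / 2 := by
    intro n
    induction n with
    | zero =>
      simp only [add_zero, pow_zero, one_mul]
      linarith
    | succ n ih =>
      have h1 := hK (K + n) (Nat.le_add_right _ _)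
      rw [Real.dist_eq] at h1
      have h2 : x (K + (n + 1)) - l = r * (x (K + n) - l) + (w (K + n) - (1 - r) * l) := by
        rw [← add_assoc, hx]
        ring
      rw [h2]
      refine (abs_add_le _ _).trans ?_
      rw [abs_mul, abs_of_nonneg hr0, pow_succ]
      have h3 := mul_le_mul_of_nonneg_left ih hr0
      linarith
  have hpow : Tendsto (fun n => r ^ n * |x K - l|) atTop (𝓝 (0 * |x K - l|)) :=
    (tendsto_pow_atTop_nhds_zero_of_lt_one hr0 hr1).mul_const _
  rw [zero_mul] at hpow
  obtain ⟨M, hM⟩ := eventually_atTop.1 (hpow.eventually (gt_mem_nhds (half_pos hε)))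
  refine ⟨K + M, fun n hn => ?_⟩
  obtain ⟨m, rfl⟩ := Nat.exists_eq_add_of_le (Nat.le_of_add_right_le hn)
  rw [Real.dist_eq]
  have h1 := hbound m
  have h2 := hM m (by omega)
  linarith

/-- A sequence of polynomials of degree `e + 1` with constant leading coefficient, whose other
coefficients grow at most like `t ^ k`, has one zero of size comparable to `t ^ k`. -/
theorem tendsto_norm_largest_root {e : ℕ} {t : ℝ} (ht : 1 < t) {p : ℕ → Polynomial ℂ} {a : ℂ}
    (ha : a ≠ 0) (hdeg : ∀ k, (p k).natDegree ≤ e + 1) (hlead : ∀ k, (p k).coeff (e + 1) = a)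
    {l : ℕ → ℂ} (hl : ∀ j ≤ e, Tendsto (fun k => (p k).coeff j / (t : ℂ) ^ k) atTop (𝓝 (l j)))
    (hl0 : l e ≠ 0) {ι : Type*} {s : Finset ι} (hs : s.Nonempty) {β : ℕ → ι → ℂ}
    (hβ : ∀ k, s.val.map (β k) = (p k).roots) {i₀ : ι} (hi₀ : i₀ ∈ s)
    (hmax : ∀ k, ∀ i ∈ s, ‖β k i‖ ≤ ‖β k i₀‖) :
    Tendsto (fun k => ‖β k i₀‖ / t ^ k) atTop (𝓝 (‖l e‖ / ‖a‖)) := by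
  have ht0 : 0 < t := one_pos.trans ht
  have htc : ∀ k : ℕ, (t : ℂ) ^ k ≠ 0 := fun k => pow_ne_zero _ (by exact_mod_cast ht0.ne')
  have hnat : ∀ k, (p k).natDegree = e + 1 := fun k =>
    Polynomial.natDegree_eq_of_le_of_coeff_ne_zero (hdeg k) (by rw [hlead]; exact ha)
  have hscard : (0 : ℝ) < s.card := by exact_mod_cast hs.card_pos
  have hna : 0 < ‖a‖ := norm_pos_iff.2 ha
  have hsum : ∀ k, (p k).coeff e = -a * ∑ i ∈ s, β k i := by
    intro k
    have h := (IsAlgClosed.splits (p k)).nextCoeff_eq_neg_sum_roots_mul_leadingCoeff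
    rw [Polynomial.nextCoeff_of_natDegree_pos (by rw [hnat]; omega), hnat, Nat.add_sub_cancel,
      Polynomial.leadingCoeff, hnat, hlead, ← hβ] at h
    exact h
  -- By Vieta the largest root is at least the average of the roots in modulus, so it grows at least
  -- like a multiple of `t ^ k`.
  have hlower : ∀ k, ‖(p k).coeff e / (t : ℂ) ^ k‖ * (s.card * ‖a‖)⁻¹ * t ^ k ≤ ‖β k i₀‖ := by
    intro k
    have h1 : ‖∑ i ∈ s, β k i‖ ≤ s.card * ‖β k i₀‖ := by
      rw [← nsmul_eq_mul]
      exact (norm_sum_le _ _).trans (Finset.sum_le_card_nsmul _ _ _ (hmax k))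
    rw [norm_div, norm_pow, Complex.norm_of_nonneg ht0.le, hsum, norm_mul, norm_neg]
    have : t ^ k ≠ 0 := (pow_pos ht0 k).ne'
    field_simp
    exact h1
  have htend : Tendsto (fun k => ‖β k i₀‖) atTop atTop := by
    refine tendsto_atTop_mono hlower (Tendsto.pos_mul_atTop (C := ‖l e‖ * (s.card * ‖a‖)⁻¹) ?_
      ((hl e le_rfl).norm.mul_const _) (tendsto_pow_atTop_atTop_of_one_lt ht))
    have := norm_pos_iff.2 hl0
    positivity
  have hinv : Tendsto (fun k => (β k i₀)⁻¹) atTop (𝓝 0) := by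
    rw [tendsto_zero_iff_norm_tendsto_zero]
    simp only [norm_inv]
    exact htend.inv_tendsto_atTop
  -- The root equation divided by `t^k β^e`: each lower term keeps a positive power of `β⁻¹`, which
  -- tends to zero.
  have hroot : ∀ k, β k i₀ ≠ 0 → a * (β k i₀ / (t : ℂ) ^ k) = -((p k).coeff e / (t : ℂ) ^ k) -
      ∑ j ∈ Finset.range e, (p k).coeff j / (t : ℂ) ^ k * (β k i₀)⁻¹ ^ (e - j) := by
    intro k h0
    have hmem : β k i₀ ∈ (p k).roots := by
      rw [← hβ]
      exact Multiset.mem_map_of_mem _ hi₀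
    have h1 := (Polynomial.mem_roots'.1 hmem).2
    rw [Polynomial.IsRoot.def, Polynomial.eval_eq_sum_range, hnat, Finset.sum_range_succ,
      Finset.sum_range_succ, hlead] at h1
    have h2 : ∑ j ∈ Finset.range e, (p k).coeff j / (t : ℂ) ^ k * (β k i₀)⁻¹ ^ (e - j)
        = (∑ j ∈ Finset.range e, (p k).coeff j * β k i₀ ^ j) / ((t : ℂ) ^ k * β k i₀ ^ e) := by
      rw [Finset.sum_div]
      refine Finset.sum_congr rfl fun j hj => ?_
      have : β k i₀ ^ e = β k i₀ ^ j * β k i₀ ^ (e - j) := by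
        rw [← pow_add, Nat.add_sub_cancel' (Finset.mem_range.1 hj).le]
      have := htc k
      rw [‹β k i₀ ^ e = _›, inv_pow]
      field_simp
    rw [h2]
    have := htc k
    field_simp
    linear_combination h1
  have hmain : Tendsto (fun k => a * (β k i₀ / (t : ℂ) ^ k)) atTop (𝓝 (-l e)) := by
    have h1 : Tendsto (fun k => -((p k).coeff e / (t : ℂ) ^ k) - ∑ j ∈ Finset.range e,
        (p k).coeff j / (t : ℂ) ^ k * (β k i₀)⁻¹ ^ (e - j)) atTop
        (𝓝 (-l e - ∑ j ∈ Finset.range e, l j * 0 ^ (e - j))) :=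
      (hl e le_rfl).neg.sub (tendsto_finsetSum _ fun j hj =>
        (hl j (Finset.mem_range.1 hj).le).mul (hinv.pow _))
    rw [Finset.sum_eq_zero, sub_zero] at h1
    · refine h1.congr' ?_
      filter_upwards [htend.eventually_gt_atTop 0] with k hk
      exact (hroot k (norm_pos_iff.1 hk)).symm
    · intro j hj
      rw [Finset.mem_range] at hj
      rw [zero_pow (by omega), mul_zero]
  have h1 := (hmain.norm).div_const ‖a‖
  rw [norm_neg] at h1
  refine h1.congr fun k => ?_
  rw [norm_mul, norm_div, norm_pow, Complex.norm_of_nonneg ht0.le]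
  field_simp

end Asymptotics

/-! ### Chain counts and numerators of iterated subdivisions -/

section Iteration

open Filter Topology

theorem bddAbove_setOf_nonempty_nondegChain (P : Type*) [PartialOrder P] [Finite P] :
    BddAbove {i : ℕ | Nonempty (NondegChain P i)} := by
  refine ⟨Nat.card P, ?_⟩
  rintro i ⟨c⟩
  have := Nat.card_le_card_of_injective c.1 c.2.injective
  rw [Nat.card_eq_fintype_card, Fintype.card_fin] at this
  omega

theorem numChains_eq_zero_of_dim_lt {P : Type*} [PartialOrder P] [Finite P] {i : ℕ}
    (h : dim P < i) : numChains P i = 0 := by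
  have : IsEmpty (NondegChain P i) := by
    rw [← not_nonempty_iff]
    exact fun hne => h.not_ge (le_csSup (bddAbove_setOf_nonempty_nondegChain P) hne)
  exact Nat.card_of_isEmpty

theorem numChains_dim_ne_zero {P : Type*} [PartialOrder P] [Finite P] (h : dim P ≠ 0) :
    numChains P (dim P) ≠ 0 := by
  have hne : {i : ℕ | Nonempty (NondegChain P i)}.Nonempty := by
    rw [Set.nonempty_iff_ne_empty]
    -- For empty `P` the supremum of the empty set is `0`, which the hypothesis excludes.
    intro h0
    rw [dim, h0] at h
    simp at h
  have : Nonempty (NondegChain P (dim P)) :=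
    Nat.sSup_mem hne (bddAbove_setOf_nonempty_nondegChain P)
  exact Nat.card_pos.ne'

universe u

variable {P : Type u} [PartialOrder P] [Fintype P] {d : ℕ}

theorem numChains_iterSd_succ {k : ℕ} (h : ∀ i, d < i → numChains (iterSd P k) i = 0) (j : ℕ) :
    numChains (iterSd P (k + 1)) j
      = ∑ i ∈ Finset.range (d + 1), f j i * numChains (iterSd P k) i := by
  simp only [f_eq_surjCount]
  rw [← numChains_sdCarrier (iterSd P k) (d + 1) (fun i hi => h i hi), iterSd,
    Function.iterate_succ_apply']
  rfl

theorem numChains_iterSd_eq_zero (h : ∀ i, d < i → numChains P i = 0) (k i : ℕ) (hi : d < i) :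
    numChains (iterSd P k) i = 0 := by
  induction k generalizing i with
  | zero => exact h i hi
  | succ k ih =>
    rw [numChains_iterSd_succ ih]
    refine Finset.sum_eq_zero fun j hj => ?_
    rw [Finset.mem_range] at hj
    rw [f_eq_surjCount, surjCount_eq_zero_of_lt (by omega), zero_mul]

theorem numChains_iterSd_top (h : ∀ i, d < i → numChains P i = 0) (k : ℕ) :
    numChains (iterSd P k) d = (d + 1).factorial ^ k * numChains P d := by
  induction k with
  | zero =>
    rw [pow_zero, one_mul]
    rfl
  | succ k ih =>
    rw [numChains_iterSd_succ (numChains_iterSd_eq_zero h k), Finset.sum_range_succ,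
      Finset.sum_eq_zero, ih, f_eq_surjCount, surjCount_self]
    · ring
    · intro j hj
      rw [Finset.mem_range] at hj
      rw [f_eq_surjCount, surjCount_eq_zero_of_lt (by omega), zero_mul]

theorem alternating_sum_numChains_iterSd (h : ∀ i, d < i → numChains P i = 0) (k : ℕ) :
    ∑ i ∈ Finset.range (d + 1), (-1) ^ i * (numChains (iterSd P k) i : ℤ)
      = ∑ i ∈ Finset.range (d + 1), (-1) ^ i * (numChains P i : ℤ) := by
  induction k with
  | zero => rfl
  | succ k ih =>
    rw [← ih]
    simp only [numChains_iterSd_succ (numChains_iterSd_eq_zero h k)]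
    push_cast
    simp only [Finset.mul_sum]
    rw [Finset.sum_comm]
    refine Finset.sum_congr rfl fun i hi => ?_
    rw [Finset.mem_range] at hi
    have h1 := sum_neg_one_pow_mul_surjCount (n := i + 1) (N := d + 2) (by omega)
    rw [Finset.sum_range_succ', surjCount_zero] at h1
    simp only [pow_succ, mul_neg, mul_one, neg_mul, Finset.sum_neg_distrib] at h1
    simp only [← mul_assoc, ← Finset.sum_mul, f_eq_surjCount]
    congr 1
    simpa using h1

/-- Downward induction on `j`: the scaled counts satisfy an affine recurrence of ratio
`(j+1)!/(d+1)! < 1`, driven by the counts with larger index, and `F_mul_sub` identifies its fixed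
point. -/
theorem tendsto_numChains_iterSd (h : ∀ i, d < i → numChains P i = 0) {j : ℕ} (hj : j ≤ d) :
    Tendsto (fun k => (numChains (iterSd P k) j : ℝ) / ((d + 1).factorial : ℝ) ^ k) atTop
      (𝓝 (numChains P d * (F j d : ℝ))) := by
  have hpos : (0 : ℝ) < (d + 1).factorial := by exact_mod_cast Nat.factorial_pos _
  induction hm : d - j using Nat.strong_induction_on generalizing j with
  | _ m ih =>
    rcases eq_or_lt_of_le hj with rfl | hlt
    · simp only [numChains_iterSd_top h, F_self]
      refine tendsto_const_nhds.congr fun k => ?_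
      push_cast
      field_simp
    · have hfac : ((j + 1).factorial : ℝ) < (d + 1).factorial := by
        exact_mod_cast factorial_lt_factorial hlt
      refine tendsto_of_affine_recurrence (r := ((j + 1).factorial : ℝ) / (d + 1).factorial)
        (w := fun k => ∑ i ∈ Finset.Ioc j d, (f j i : ℝ) / (d + 1).factorial *
          ((numChains (iterSd P k) i : ℝ) / ((d + 1).factorial : ℝ) ^ k))
        (by positivity) ((div_lt_one hpos).2 hfac) ?_ ?_
      · intro k
        have hsub : Finset.Icc j d ⊆ Finset.range (d + 1) := fun i hi => by
          rw [Finset.mem_Icc] at hi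
          rw [Finset.mem_range]
          omega
        rw [numChains_iterSd_succ (numChains_iterSd_eq_zero h k), ← Finset.sum_subset hsub,
          ← Finset.Ioc_insert_left hj, Finset.sum_insert (by simp)]
        · rw [f_eq_surjCount, surjCount_self]
          push_cast
          rw [add_div, Finset.sum_div, pow_succ]
          congr 1
          · field_simp
          · refine Finset.sum_congr rfl fun i _ => ?_
            field_simp
        · intro i hi hi'
          rw [Finset.mem_range] at hi
          rw [Finset.mem_Icc] at hi'
          rw [f_eq_surjCount, surjCount_eq_zero_of_lt (by omega), zero_mul]
      · have hF : (F j d : ℝ) * (((d + 1).factorial : ℝ) - (j + 1).factorial)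
            = ∑ i ∈ Finset.Ioc j d, (f j i : ℝ) * (F i d : ℝ) := by
          exact_mod_cast congrArg (Rat.cast (K := ℝ)) (F_mul_sub hlt)
        have hw : (1 - ((j + 1).factorial : ℝ) / (d + 1).factorial) * (numChains P d * (F j d : ℝ))
            = ∑ i ∈ Finset.Ioc j d, (f j i : ℝ) / (d + 1).factorial *
              (numChains P d * (F i d : ℝ)) := by
          have h1 : ∑ i ∈ Finset.Ioc j d, (f j i : ℝ) / (d + 1).factorial *
              (numChains P d * (F i d : ℝ))
              = (∑ i ∈ Finset.Ioc j d, (f j i : ℝ) * (F i d : ℝ)) *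
                ((numChains P d : ℝ) / (d + 1).factorial) := by
            rw [Finset.sum_mul]
            refine Finset.sum_congr rfl fun i _ => ?_
            ring
          rw [h1, ← hF]
          field_simp
        rw [hw]
        refine tendsto_finsetSum _ fun i hi => Tendsto.const_mul _ ?_
        rw [Finset.mem_Ioc] at hi
        exact ih (d - i) (by omega) hi.2 rfl

theorem tendsto_coeff_numerPoly (h : ∀ i, d < i → numChains P i = 0) (j : ℕ) :
    Tendsto (fun k => (numerPoly (fun i => (numChains (iterSd P k) i : ℂ)) d).coeff j /
        (((d + 1).factorial : ℝ) : ℂ) ^ k) atTop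
      (𝓝 ((numerPoly (fun i => ((numChains P d * (F i d : ℝ) : ℝ) : ℂ)) d).coeff j)) := by
  simp only [coeff_numerPoly, Finset.sum_div]
  refine tendsto_finsetSum _ fun i hi => ?_
  rw [Finset.mem_range] at hi
  have h1 := (Complex.continuous_ofReal.tendsto _).comp
    (tendsto_numChains_iterSd h (Nat.lt_succ_iff.1 hi))
  refine (h1.mul_const _).congr fun k => ?_
  simp only [Function.comp_apply]
  push_cast
  rw [div_mul_eq_mul_div]

/-- Reversing `∑ F_{i,d} s^i (1-s)^(d-i)` gives `F_d(s-1) = ∑ H_{j,d} s^j`, so the coefficient just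
below degree `d` is `H_{1,d}`. -/
theorem coeff_numerPoly_limit {e : ℕ} (c : ℝ) :
    (numerPoly (fun i => ((c * (F i (e + 1) : ℝ) : ℝ) : ℂ)) (e + 1)).coeff e
      = ((c * (H 1 (e + 1) : ℝ) : ℝ) : ℂ) := by
  rw [H_one_eq_sum, coeff_numerPoly]
  push_cast
  rw [Finset.mul_sum]
  refine Finset.sum_congr rfl fun i hi => ?_
  rw [Finset.mem_range] at hi
  rcases Nat.lt_succ_iff_lt_or_eq.1 hi with hlt | rfl
  · obtain ⟨m, rfl⟩ := Nat.exists_eq_add_of_le (Nat.lt_succ_iff.1 hlt)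
    rw [if_pos (by omega), show i + m + 1 - i = m + 1 by omega, Nat.add_sub_cancel_left,
      Nat.add_sub_cancel, Nat.choose_succ_self_right]
    push_cast
    ring
  · rw [if_neg (by omega), Nat.sub_self]
    simp

end Iteration

end PosetZeta

theorem mainTheorem3 {P : Type*} [PartialOrder P] [Fintype P] (d : ℕ) (hd : 1 ≤ d)
    (hdim : PosetZeta.dim P = d) (hχ : PosetZeta.eulerChar P ≠ 0)
    (β : ℕ → ℕ → ℂ)
    (hβ : ∀ k, (Finset.Icc 1 d).val.map (β k) = PosetZeta.zetaZeros (PosetZeta.iterSd P k))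
    (hmax : ∀ k, ∀ i ∈ Finset.Icc 1 d, ‖β k i‖ ≤ ‖β k 1‖) :
    Filter.Tendsto
      (fun k : ℕ => ‖β k 1‖ /
        (((d + 1).factorial : ℝ) ^ k * (PosetZeta.H 1 d : ℝ) *
          (Nat.card (PosetZeta.NondegChain P d) : ℝ) / |(PosetZeta.eulerChar P : ℝ)|))
      Filter.atTop (nhds 1) := by
  obtain ⟨e, rfl⟩ : ∃ e, d = e + 1 := ⟨d - 1, by omega⟩
  have hvan : ∀ i, e + 1 < i → PosetZeta.numChains P i = 0 := fun i hi =>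
    PosetZeta.numChains_eq_zero_of_dim_lt (hdim ▸ hi)
  have hc : PosetZeta.numChains P (e + 1) ≠ 0 :=
    hdim ▸ PosetZeta.numChains_dim_ne_zero (P := P) (by omega)
  have hcpos : (0 : ℝ) < PosetZeta.numChains P (e + 1) := by exact_mod_cast Nat.pos_of_ne_zero hc
  have hH : (0 : ℝ) < (PosetZeta.H 1 (e + 1) : ℝ) := by exact_mod_cast PosetZeta.H_one_pos hd
  have hΛ : (1 : ℝ) < (e + 1 + 1).factorial := by
    exact_mod_cast Nat.one_lt_factorial.2 (by omega)
  have hχ' : ∑ i ∈ Finset.range (e + 1 + 1), (-1) ^ i * (PosetZeta.numChains P i : ℤ)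
      = PosetZeta.eulerChar P := by
    rw [PosetZeta.eulerChar, hdim]
    rfl
  have hroots : ∀ k, (Finset.Icc 1 (e + 1)).val.map (β k) = (PosetZeta.numerPoly
      (fun i => (PosetZeta.numChains (PosetZeta.iterSd P k) i : ℂ)) (e + 1)).roots := fun k => by
    rw [hβ]
    refine PosetZeta.zetaZeros_eq_roots _ _ (PosetZeta.numChains_iterSd_eq_zero hvan k) ?_
    rw [PosetZeta.numChains_iterSd_top hvan]
    exact mul_ne_zero (pow_ne_zero _ (Nat.factorial_ne_zero _)) hc
  have hlead : ∀ k, (PosetZeta.numerPoly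
      (fun i => (PosetZeta.numChains (PosetZeta.iterSd P k) i : ℂ)) (e + 1)).coeff (e + 1)
        = (-1) ^ (e + 1) * (PosetZeta.eulerChar P : ℂ) := fun k => by
    rw [PosetZeta.coeff_numerPoly_self, ← hχ',
      ← PosetZeta.alternating_sum_numChains_iterSd hvan k]
    push_cast
    rfl
  have key := PosetZeta.tendsto_norm_largest_root hΛ (e := e)
    (mul_ne_zero (pow_ne_zero _ (neg_ne_zero.2 one_ne_zero)) (Int.cast_ne_zero.2 hχ))
    (fun k => PosetZeta.natDegree_numerPoly_le _ _) hlead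
    (fun j _ => PosetZeta.tendsto_coeff_numerPoly hvan j)
    (by
      rw [PosetZeta.coeff_numerPoly_limit]
      -- Positivity of `H 1 d` enters here: the limiting subleading coefficient is nonzero.
      exact_mod_cast (mul_pos hcpos hH).ne')
    ⟨1, Finset.mem_Icc.2 ⟨le_rfl, hd⟩⟩ hroots (Finset.mem_Icc.2 ⟨le_rfl, hd⟩) hmax
  rw [PosetZeta.coeff_numerPoly_limit, Complex.norm_of_nonneg (mul_pos hcpos hH).le, norm_mul,
    norm_pow, norm_neg, norm_one, one_pow, one_mul, Complex.norm_intCast] at key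
  have hχabs : (0 : ℝ) < |(PosetZeta.eulerChar P : ℝ)| := abs_pos.2 (Int.cast_ne_zero.2 hχ)
  have hL : (PosetZeta.numChains P (e + 1) * (PosetZeta.H 1 (e + 1) : ℝ)) /
      |(PosetZeta.eulerChar P : ℝ)| ≠ 0 := (div_pos (mul_pos hcpos hH) hχabs).ne'
  have h1 := key.div_const ((PosetZeta.numChains P (e + 1) * (PosetZeta.H 1 (e + 1) : ℝ)) /
      |(PosetZeta.eulerChar P : ℝ)|)
  rw [div_self hL] at h1
  refine h1.congr fun k => ?_
  change _ = ‖β k 1‖ / (_ * _ * (PosetZeta.numChains P (e + 1) : ℝ) / _)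
  field_simp
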